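/- A \emph{primed ringed space} $(X,M)$ is a ringed space $X$ together with a set $M_x \subseteq \operatorname{Spec} \mathcal O_{X,x}$ of prime ideals for every point $x \in X$; a morphism $(X,M) \to (Y,N)$ is a morphism $f : X \to Y$ of ringed spaces with $f_x^{-1}(z) \in N_{f(x)}$ for all $x \in X$ and $z \in M_x$. A locally ringed space $X$ is regarded as the primed ringed space $(X,\mathcal M_X)$, where $\mathcal M_{X,x} = \{\mathfrak m_x\}$ (the local prime system). The \emph{localization} $(X,M)^{\mathrm{loc}}$ of a primed ringed space is the following locally ringed space. Its points are the pairs $(x,z)$ with $x \in X$ and $z \in M_x$. Its topology has as a basis the sets $\{(x,z) : x \in U,\ s_x \notin z\}$, for $U \subseteq X$ open and $s \in \mathcal O_X(U)$. Its sections over an open set $V$ are the families $(f(x,z))_{(x,z) \in V}$ with $f(x,z) \in (\mathcal O_{X,x})_z$ that are, locally on $V$, of the form $f(x,z) = a_x/t_x$ with $a,t \in \mathcal O_X(U)$ for some open $U \subseteq X$ (where $x\in U$ and $t_x \notin z$ at all points concerned). It comes with a morphism of primed ringed spaces $\pi : ((X,M)^{\mathrm{loc}}, \mathcal M_{(X,M)^{\mathrm{loc}}})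 \to (X,M)$, given by $(x,z) \mapsto x$ on points and by $s \mapsto (s_x)_{(x,z)}$ on sections. Corollary. The category of locally ringed spaces has all (small) inverse limits. More precisely, let $j \mapsto X_j$ be a diagram of locally ringed spaces indexed by a small category. Then the diagram $j \mapsto (X_j,\mathcal M_{X_j})$ has an inverse limit in the category of primed ringed spaces; and if $(X,M)$, with projections $p_j : (X,M) \to (X_j,\mathcal M_{X_j})$, is such a limit, then the composites $p_j \circ \pi : (X,M)^{\mathrm{loc}} \to X_j$ are morphisms of locally ringed spaces, and they make $(X,M)^{\mathrm{loc}}$ an inverse limit of the diagram $j \mapsto X_j$ in the category of locally ringed spaces. -/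

import Mathlib

open CategoryTheory CategoryTheory.Limits TopologicalSpace Opposite

universe u

noncomputable section

namespace AlgebraicGeometry

/-- A primed ringed space: a ringed space (with arbitrary commutative rings as stalks) together with
a prime system, that is, a set of prime ideals of the stalk at every point. -/
structure PrimedRingedSpace extends SheafedSpace CommRingCat.{u} where
  /-- The chosen set of prime ideals of each stalk. -/
  primes : ∀ x : carrier, Set (PrimeSpectrum (presheaf.stalk x))

namespace PrimedRingedSpace

/-- A morphism of primed ringed spaces: a morphism `f` of ringed spaces such that `Spec f_x` sends
the chosen primes at `x` to chosen primes at `f x`. -/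
@[ext]
structure Hom (X Y : PrimedRingedSpace.{u}) where
  /-- The underlying morphism of ringed spaces. -/
  toHom : X.toSheafedSpace ⟶ Y.toSheafedSpace
  comap_mem : ∀ (x : X.carrier), ∀ z ∈ X.primes x,
    PrimeSpectrum.comap (toHom.hom.stalkMap x).hom z ∈ Y.primes (toHom.hom.base x)

/-- The category of primed ringed spaces. -/
instance : Category PrimedRingedSpace.{u} where
  Hom := Hom
  id X := ⟨𝟙 X.toSheafedSpace, fun x z hz => by
    have h : (𝟙 X.toSheafedSpace : X.toSheafedSpace ⟶ _).hom.stalkMap x = 𝟙 _ :=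
      PresheafedSpace.stalkMap.id X.toPresheafedSpace x
    rw [h]
    exact hz⟩
  comp {X Y Z} f g := ⟨f.toHom ≫ g.toHom, fun x z hz => by
    have h : (f.toHom ≫ g.toHom).hom.stalkMap x =
        g.toHom.hom.stalkMap (f.toHom.hom.base x) ≫ f.toHom.hom.stalkMap x :=
      PresheafedSpace.stalkMap.comp f.toHom.hom g.toHom.hom x
    rw [h]
    exact g.comap_mem _ _ (f.comap_mem x z hz)⟩
  id_comp f := Hom.ext (Category.id_comp f.toHom)
  comp_id f := Hom.ext (Category.comp_id f.toHom)
  assoc f g h := Hom.ext (Category.assoc f.toHom g.toHom h.toHom)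

/-- The functor from locally ringed spaces to primed ringed spaces that equips a locally ringed
space with its local prime system, whose only prime at `x` is the maximal ideal of the stalk. -/
def ofLocallyRingedSpace : LocallyRingedSpace.{u} ⥤ PrimedRingedSpace.{u} where
  obj X := { X.toSheafedSpace with
    primes := fun x => {IsLocalRing.closedPoint (X.presheaf.stalk x)} }
  map {X Y} f := ⟨f.toShHom, fun x z hz => by
    obtain rfl := Set.mem_singleton_iff.mp hz
    exact IsLocalRing.comap_closedPoint (f.stalkMap x).hom⟩
  map_id _ := rfl
  map_comp _ _ := rfl

variable (X : PrimedRingedSpace.{u})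

/-- The points of the localization: pairs of a point `x` and a chosen prime of the stalk at `x`. -/
structure LocPoint where
  /-- The point of the original space. -/
  pt : X.carrier
  /-- The prime ideal of the stalk. -/
  prime : PrimeSpectrum (X.presheaf.stalk pt)
  mem : prime ∈ X.primes pt

variable {X} in
/-- The basic open set attached to a section `s` over `U`: the points `(x, z)` with `x ∈ U` and
`s_x ∉ z`. -/
def locBasicOpen (U : Opens X.carrier) (s : X.presheaf.obj (op U)) : Set X.LocPoint :=
  {p | ∃ h : p.pt ∈ U, X.presheaf.germ U p.pt h s ∉ p.prime.asIdeal}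

/-- The topology of the localization, generated by the basic open sets. -/
instance : TopologicalSpace X.LocPoint :=
  .generateFrom {B | ∃ U s, B = locBasicOpen U s}

/-- The underlying space of the localization. -/
abbrev locTop : TopCat.{u} := TopCat.of X.LocPoint

variable {X} in
/-- The local ring at the point `(x, z)`: the stalk at `x` localized at `z`. -/
abbrev LocStalk (p : X.LocPoint) : Type u := Localization.AtPrime p.prime.asIdeal

variable {X} in
/-- The predicate that a family of elements `f p` of the local rings `LocStalk p`, for `p` in `V`,
is of the form `(x, z) ↦ a_x / t_x` for sections `a`, `t` of the structure sheaf over some open set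
`U`, where `t_x ∉ z` at all points of `V`. -/
def IsFraction {V : Opens X.locTop} (f : ∀ p : V, LocStalk p.1) : Prop :=
  ∃ (U : Opens X.carrier) (a t : X.presheaf.obj (op U)), ∀ p : V, ∃ (h : p.1.pt ∈ U)
    (ht : X.presheaf.germ U p.1.pt h t ∈ p.1.prime.asIdeal.primeCompl),
    f p = Localization.mk (X.presheaf.germ U p.1.pt h a) ⟨X.presheaf.germ U p.1.pt h t, ht⟩

/-- Being a fraction is stable under restriction. -/
def isFraction : TopCat.PrelocalPredicate (X := X.locTop) (fun p => LocStalk p) where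
  pred f := IsFraction f
  res i _ := fun ⟨U, a, t, H⟩ => ⟨U, a, t, fun p => H ⟨p.1, i.le p.2⟩⟩

/-- The local consistency condition: a family of germs is locally a fraction. -/
def isLocallyFraction : TopCat.LocalPredicate (X := X.locTop) (fun p => LocStalk p) :=
  X.isFraction.sheafify

/-- The ring of sections over `V` of the structure sheaf of the localization. -/
def locSections (V : Opens X.locTop) : Subring (∀ p : V, LocStalk p.1) where
  carrier := {f | X.isLocallyFraction.pred f}
  zero_mem' p := ⟨V, p.2, 𝟙 _, ⊤, 0, 1, fun q => ⟨trivial, by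
    rw [map_one]; exact one_mem _, by
    rw [map_zero, Localization.mk_zero]; rfl⟩⟩
  one_mem' p := ⟨V, p.2, 𝟙 _, ⊤, 1, 1, fun q => ⟨trivial, by
    rw [map_one]; exact one_mem _, by
    simp only [map_one]; exact Localization.mk_one.symm⟩⟩
  add_mem' {f g} hf hg p := by
    obtain ⟨V₁, m₁, i₁, U₁, a₁, t₁, H₁⟩ := hf p
    obtain ⟨V₂, m₂, i₂, U₂, a₂, t₂, H₂⟩ := hg p
    let j₁ := X.presheaf.map (homOfLE (inf_le_left : U₁ ⊓ U₂ ≤ U₁)).op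
    let j₂ := X.presheaf.map (homOfLE (inf_le_right : U₁ ⊓ U₂ ≤ U₂)).op
    refine ⟨V₁ ⊓ V₂, ⟨m₁, m₂⟩, homOfLE (inf_le_left.trans i₁.le), U₁ ⊓ U₂,
      j₁ t₁ * j₂ a₂ + j₂ t₂ * j₁ a₁, j₁ t₁ * j₂ t₂, fun q => ?_⟩
    obtain ⟨h₁, n₁, e₁⟩ := H₁ ⟨q.1, q.2.1⟩
    obtain ⟨h₂, n₂, e₂⟩ := H₂ ⟨q.1, q.2.2⟩
    have r₁ (s) : X.presheaf.germ (U₁ ⊓ U₂) q.1.pt ⟨h₁, h₂⟩ (j₁ s) = X.presheaf.germ U₁ _ h₁ s :=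
      TopCat.Presheaf.germ_res_apply ..
    have r₂ (s) : X.presheaf.germ (U₁ ⊓ U₂) q.1.pt ⟨h₁, h₂⟩ (j₂ s) = X.presheaf.germ U₂ _ h₂ s :=
      TopCat.Presheaf.germ_res_apply ..
    refine ⟨⟨h₁, h₂⟩, by rw [map_mul, r₁, r₂]; exact mul_mem n₁ n₂, ?_⟩
    simp only [map_add, map_mul, r₁, r₂]
    exact (congrArg₂ (· + ·) e₁ e₂).trans (Localization.add_mk ..)
  mul_mem' {f g} hf hg p := by
    obtain ⟨V₁, m₁, i₁, U₁, a₁, t₁, H₁⟩ := hf p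
    obtain ⟨V₂, m₂, i₂, U₂, a₂, t₂, H₂⟩ := hg p
    let j₁ := X.presheaf.map (homOfLE (inf_le_left : U₁ ⊓ U₂ ≤ U₁)).op
    let j₂ := X.presheaf.map (homOfLE (inf_le_right : U₁ ⊓ U₂ ≤ U₂)).op
    refine ⟨V₁ ⊓ V₂, ⟨m₁, m₂⟩, homOfLE (inf_le_left.trans i₁.le), U₁ ⊓ U₂,
      j₁ a₁ * j₂ a₂, j₁ t₁ * j₂ t₂, fun q => ?_⟩
    obtain ⟨h₁, n₁, e₁⟩ := H₁ ⟨q.1, q.2.1⟩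
    obtain ⟨h₂, n₂, e₂⟩ := H₂ ⟨q.1, q.2.2⟩
    have r₁ (s) : X.presheaf.germ (U₁ ⊓ U₂) q.1.pt ⟨h₁, h₂⟩ (j₁ s) = X.presheaf.germ U₁ _ h₁ s :=
      TopCat.Presheaf.germ_res_apply ..
    have r₂ (s) : X.presheaf.germ (U₁ ⊓ U₂) q.1.pt ⟨h₁, h₂⟩ (j₂ s) = X.presheaf.germ U₂ _ h₂ s :=
      TopCat.Presheaf.germ_res_apply ..
    refine ⟨⟨h₁, h₂⟩, by rw [map_mul, r₁, r₂]; exact mul_mem n₁ n₂, ?_⟩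
    simp only [map_mul, r₁, r₂]
    exact (congrArg₂ (· * ·) e₁ e₂).trans (Localization.mk_mul ..)
  neg_mem' {f} hf p := by
    obtain ⟨V, m, i, U, a, t, H⟩ := hf p
    refine ⟨V, m, i, U, -a, t, fun q => ?_⟩
    obtain ⟨h, n, e⟩ := H q
    refine ⟨h, n, ?_⟩
    rw [map_neg]
    exact (congrArg (- ·) e).trans (Localization.neg_mk ..)

/-- The structure presheaf of the localization. -/
def locPresheaf : TopCat.Presheaf CommRingCat.{u} X.locTop where
  obj V := CommRingCat.of (X.locSections V.unop)
  map i := CommRingCat.ofHom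
    { toFun := fun f => ⟨fun p => f.1 ⟨p.1, i.unop.le p.2⟩, X.isLocallyFraction.res i.unop _ f.2⟩
      map_one' := rfl
      map_mul' := fun _ _ => rfl
      map_zero' := rfl
      map_add' := fun _ _ => rfl }

theorem locPresheaf_isSheaf : X.locPresheaf.IsSheaf :=
  (TopCat.Presheaf.isSheaf_iff_isSheaf_comp (forget CommRingCat) _).mpr
    (TopCat.Presheaf.isSheaf_of_iso (F := (TopCat.subsheafToTypes X.isLocallyFraction).1)
      (NatIso.ofComponents fun _ => Iso.refl _)
      (TopCat.subsheafToTypes X.isLocallyFraction).2)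

/-- The localization of a primed ringed space, as a ringed space. -/
def locSheafedSpace : SheafedSpace CommRingCat.{u} where
  carrier := X.locTop
  presheaf := X.locPresheaf
  IsSheaf := X.locPresheaf_isSheaf

/-- Evaluation of sections of the localization at a point. -/
def locStalkCocone (p : X.LocPoint) :
    Cocone ((OpenNhds.inclusion (X := X.locTop) p).op ⋙ X.locPresheaf) where
  pt := CommRingCat.of (LocStalk p)
  ι :=
    { app := fun V => CommRingCat.ofHom
        ((Pi.evalRingHom (fun q : V.unop.1 => LocStalk q.1) ⟨p, V.unop.2⟩).comp
          (X.locSections V.unop.1).subtype)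
      naturality := fun _ _ _ => rfl }

/-- The evaluation map from the stalk of the localization at `(x, z)` to the stalk at `x` localized
at `z`. -/
def locStalkHom (p : X.LocPoint) :
    X.locPresheaf.stalk (X := X.locTop) p ⟶ CommRingCat.of (LocStalk p) :=
  colimit.desc _ (X.locStalkCocone p)

theorem locStalkHom_germ (p : X.LocPoint) (V : Opens X.locTop) (hp : p ∈ V)
    (f : X.locSections V) :
    (X.locStalkHom p).hom (X.locPresheaf.germ V p hp f) = f.1 ⟨p, hp⟩ :=
  ConcreteCategory.congr_hom (colimit.ι_desc (X.locStalkCocone p) (op ⟨V, hp⟩)) f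

theorem isOpen_locBasicOpen (U : Opens X.carrier) (s : X.presheaf.obj (op U)) :
    IsOpen (locBasicOpen U s) :=
  .basic _ ⟨U, s, rfl⟩

theorem continuous_pt : Continuous (LocPoint.pt : X.LocPoint → X.carrier) := by
  refine continuous_def.mpr fun U hU => ?_
  convert X.isOpen_locBasicOpen ⟨U, hU⟩ 1 using 1
  ext p
  refine ⟨fun h => ⟨h, ?_⟩, fun h => h.1⟩
  rw [map_one]
  exact p.prime.asIdeal.one_notMem

instance isLocalHom_locStalkHom (p : X.LocPoint) : IsLocalHom (X.locStalkHom p).hom := by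
  refine ⟨fun s hs => ?_⟩
  obtain ⟨V, hp, f, rfl⟩ := TopCat.Presheaf.exists_germ_eq X.locPresheaf (x := p) s
  replace hs : IsUnit (f.1 ⟨p, hp⟩) := (congrArg IsUnit (X.locStalkHom_germ p V hp f)).mp hs
  obtain ⟨W, hW, i, U, a, t, H⟩ := f.2 ⟨p, hp⟩
  obtain ⟨h, n, e⟩ := H ⟨p, hW⟩
  have ha : X.presheaf.germ U p.pt h a ∈ p.prime.asIdeal.primeCompl := by
    have e' : f.1 ⟨p, hp⟩ = _ := e
    rw [e', Localization.mk_eq_mk'] at hs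
    exact (IsLocalization.AtPrime.isUnit_mk'_iff _ p.prime.asIdeal _ _).mp hs
  let W' : Opens X.locTop := W ⊓ ⟨locBasicOpen U a, X.isOpen_locBasicOpen U a⟩
  have hW' : p ∈ W' := ⟨hW, h, ha⟩
  let g : X.locSections W' := ⟨fun q => Localization.mk
    (X.presheaf.germ U q.1.pt q.2.2.1 t) ⟨X.presheaf.germ U q.1.pt q.2.2.1 a, q.2.2.2⟩,
    fun q => ⟨W', q.2, 𝟙 _, U, t, a, fun r => ⟨r.2.2.1, r.2.2.2, rfl⟩⟩⟩
  have hj : W' ≤ V := inf_le_left.trans i.le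
  let f' : X.locSections W' := X.locPresheaf.map (homOfLE hj).op f
  have hfg : f' * g = 1 := by
    refine Subtype.ext (funext fun q => ?_)
    obtain ⟨h', n', e'⟩ := H ⟨q.1, q.2.1⟩
    refine (congrArg (· * g.1 q) e').trans ?_
    refine (Localization.mk_mul ..).trans ?_
    exact (Localization.mk_eq_mk_iff.mpr (Localization.r_iff_exists.mpr ⟨1, by
      simp only [OneMemClass.coe_one, Submonoid.coe_mul, one_mul, mul_one]
      exact mul_comm _ _⟩)).trans Localization.mk_one
  have hu : IsUnit (X.locPresheaf.germ (X := X.locTop) W' p hW' f') :=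
    (IsUnit.of_mul_eq_one (M := X.locSections W') g hfg).map
      (X.locPresheaf.germ (X := X.locTop) W' p hW').hom
  have he : X.locPresheaf.germ (X := X.locTop) W' p hW' f' = X.locPresheaf.germ V p hp f :=
    TopCat.Presheaf.germ_res_apply ..
  rwa [he] at hu

/-- The localization of a primed ringed space, a locally ringed space. -/
def loc : LocallyRingedSpace.{u} where
  __ := X.locSheafedSpace
  isLocalRing p :=
    @RingHom.domain_isLocalRing _ _ _ _ _ (X.locStalkHom p).hom (X.isLocalHom_locStalkHom p)

/-- The projection from the localization to the original ringed space. On points it is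
`(x, z) ↦ x`, on sections it sends `s` to the family of the images of the germs `s_x` in the
localized stalks. -/
def locπHom : X.loc.toSheafedSpace ⟶ X.toSheafedSpace :=
  InducedCategory.homMk
    { base := TopCat.ofHom ⟨LocPoint.pt, X.continuous_pt⟩
      c :=
        { app := fun U => CommRingCat.ofHom
            { toFun := fun s => (⟨fun p => algebraMap _ (LocStalk p.1)
                  (X.presheaf.germ U.unop p.1.pt p.2 s), fun p =>
                  ⟨_, p.2, 𝟙 _, U.unop, s, 1, fun q => ⟨q.2, by
                    rw [map_one]; exact one_mem _, by
                    simp only [map_one]; exact (Localization.mk_one_eq_algebraMap _).symm⟩⟩⟩ :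
                  X.locSections _)
              map_one' := Subtype.ext (funext fun p => by simp)
              map_mul' := fun a b => Subtype.ext (funext fun p => by simp)
              map_zero' := Subtype.ext (funext fun p => by simp)
              map_add' := fun a b => Subtype.ext (funext fun p => by simp) }
          naturality := fun U V i => by
            ext s
            refine Subtype.ext (funext fun p => ?_)
            exact congrArg (algebraMap _ (LocStalk p.1))
              (TopCat.Presheaf.germ_res_apply X.presheaf i.unop p.1.pt p.2 s) } }

/-- The composite of the stalk map of the projection with the evaluation map is the localization
map. -/
theorem stalkMap_locπHom (p : X.LocPoint) (s : X.presheaf.stalk p.pt) :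
    (X.locStalkHom p).hom ((X.locπHom.hom.stalkMap p).hom s) = algebraMap _ (LocStalk p) s := by
  obtain ⟨U, hp, s, rfl⟩ := TopCat.Presheaf.exists_germ_eq X.presheaf s
  refine (congrArg (X.locStalkHom p).hom
    (PresheafedSpace.stalkMap_germ_apply X.locπHom.hom U p hp s)).trans ?_
  exact X.locStalkHom_germ p _ hp _

/-- The maximal ideal of the stalk of the localization at `(x, z)` lies over `z`. -/
theorem comap_locπHom (p : X.LocPoint) :
    PrimeSpectrum.comap (X.locπHom.hom.stalkMap p).hom
      (@IsLocalRing.closedPoint (X.loc.presheaf.stalk p) _ (X.loc.isLocalRing p)) = p.prime := by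
  refine PrimeSpectrum.ext (Ideal.ext fun (s : X.presheaf.stalk p.pt) => ?_)
  have hs : IsUnit ((X.locπHom.hom.stalkMap p).hom s) ↔ IsUnit (algebraMap _ (LocStalk p) s) := by
    rw [← stalkMap_locπHom]
    exact (@isUnit_map_iff _ _ _ _ _ _ _ (X.locStalkHom p).hom (X.isLocalHom_locStalkHom p) _).symm
  exact (hs.trans
    (IsLocalization.AtPrime.isUnit_to_map_iff _ p.prime.asIdeal s)).not.trans not_not

/-- The projection from the localization, equipped with its local prime system, as a morphism of
primed ringed spaces. -/
def locπ : ofLocallyRingedSpace.obj X.loc ⟶ X where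
  toHom := X.locπHom
  comap_mem p z hz := by
    obtain rfl := Set.mem_singleton_iff.mp hz
    exact Set.mem_of_eq_of_mem (X.comap_locπHom p) (LocPoint.mem p)

end PrimedRingedSpace
end AlgebraicGeometry
end

/-! Localization is right adjoint to the fully faithful functor `ofLocallyRingedSpace`. A primed
morphism `f` from a locally ringed space `Y` to `X` sends the maximal ideal at `y` to a chosen prime
at `f y`, so it determines a point of `X.loc`. The stalk map inverts everything outside that prime,
hence factors through the localized stalk by a local homomorphism, and fractions pull back to
fractions. This lift is the only one (`existsUnique_lift`).

If `c` is a limit of the diagram in primed ringed spaces, then cones from `Y` over `F`, primed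
morphisms from `Y` to `c.pt` and morphisms from `Y` to `c.pt.loc` all correspond. So `c.pt.loc` is
the limit of `F` (`isLimitLoc`).

Primed limits exist because limits of ringed spaces do: the latter receive the largest prime system
that makes the projections primed (`isLimitPrimedCone`). A limit of ringed spaces is the limit of
the underlying topological spaces with the sheafification of a presheaf of rings universal for
compatible pullbacks of sections (`isLimitLimCone`). -/

noncomputable section

/-! ### Sections and morphisms of ringed spaces are determined by germs. -/

namespace AlgebraicGeometry

/-- A family of germs that is locally given by sections is given by a section. -/
theorem SheafedSpace.exists_germ_eq_of_locally (Y : SheafedSpace CommRingCat.{u})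
    (U : Opens Y.carrier) (t : ∀ y ∈ U, Y.presheaf.stalk y)
    (h : ∀ y ∈ U, ∃ (V : Opens Y.carrier) (_ : y ∈ V) (hV : V ≤ U) (s : Y.presheaf.obj (op V)),
      ∀ (z : Y.carrier) (hz : z ∈ V), Y.presheaf.germ V z hz s = t z (hV hz)) :
    ∃ s : Y.presheaf.obj (op U), ∀ (y : Y.carrier) (hy : y ∈ U),
      Y.presheaf.germ U y hy s = t y hy := by
  choose V hyV hVU s hs using fun y : U => h y.1 y.2
  -- On an overlap both sections have germ `t z` at every point `z`, so they agree there.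
  obtain ⟨gl, hgl, -⟩ := Y.sheaf.existsUnique_gluing' V U (fun y => homOfLE (hVU y))
    (fun y hy => Opens.mem_iSup.mpr ⟨⟨y, hy⟩, hyV ⟨y, hy⟩⟩) s (fun x y =>
      TopCat.Presheaf.section_ext Y.sheaf _ _ _ fun z hz =>
        (TopCat.Presheaf.germ_res_apply Y.presheaf (Opens.infLELeft (V x) (V y)) z hz (s x)).trans
          (((hs x z hz.1).trans (hs y z hz.2).symm).trans
            (TopCat.Presheaf.germ_res_apply Y.presheaf
              (Opens.infLERight (V x) (V y)) z hz (s y)).symm))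
  refine ⟨gl, fun y hy => ?_⟩
  rw [← hs ⟨y, hy⟩ y (hyV ⟨y, hy⟩), ← hgl ⟨y, hy⟩]
  exact (TopCat.Presheaf.germ_res_apply Y.presheaf (homOfLE (hVU ⟨y, hy⟩)) y _ gl).symm

theorem SheafedSpace.section_ext (Y : SheafedSpace CommRingCat.{u}) {U : Opens Y.carrier}
    {s t : Y.presheaf.obj (op U)}
    (h : ∀ (y : Y.carrier) (hy : y ∈ U),
      Y.presheaf.germ U y hy s = Y.presheaf.germ U y hy t) : s = t :=
  TopCat.Presheaf.section_ext Y.sheaf U s t h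

/-- Morphisms of ringed spaces agree if they have the same underlying map and pull back sections
to sections with the same germs. -/
theorem SheafedSpace.hom_ext_germ {Y Z : SheafedSpace CommRingCat.{u}} {f g : Y ⟶ Z}
    (hb : f.hom.base = g.hom.base)
    (hc : ∀ (V : Opens Z.carrier) (s : Z.presheaf.obj (op V)) (y : Y.carrier)
      (hf : f.hom.base y ∈ V) (hg : g.hom.base y ∈ V),
      Y.presheaf.germ ((Opens.map f.hom.base).obj V) y hf (f.hom.c.app (op V) s) =
        Y.presheaf.germ ((Opens.map g.hom.base).obj V) y hg (g.hom.c.app (op V) s)) : f = g := by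
  obtain ⟨⟨fb, fc⟩⟩ := f
  obtain ⟨⟨gb, gc⟩⟩ := g
  -- Germs at `y` live in one stalk whichever preimage of `V` is used, so `hc` makes sense before
  -- the base maps are identified.
  obtain rfl : fb = gb := hb
  obtain rfl : fc = gc := by
    refine NatTrans.ext (funext fun V => ?_)
    ext s
    exact Y.section_ext fun y hy => hc V.unop s y hy hy
  rfl

/-! ### The universal property of the localization. -/

namespace PrimedRingedSpace

theorem ofLocallyRingedSpace_map_injective {Y Z : LocallyRingedSpace.{u}} {f g : Y ⟶ Z}
    (h : ofLocallyRingedSpace.map f = ofLocallyRingedSpace.map g) : f = g :=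
  LocallyRingedSpace.forgetToSheafedSpace.map_injective (congrArg Hom.toHom h)

/-- A morphism of primed ringed spaces between locally ringed spaces is a morphism of locally
ringed spaces. -/
def homOfPrimed {Y Z : LocallyRingedSpace.{u}}
    (f : ofLocallyRingedSpace.obj Y ⟶ ofLocallyRingedSpace.obj Z) : Y ⟶ Z :=
  let f' : Y.toSheafedSpace ⟶ Z.toSheafedSpace := f.toHom
  LocallyRingedSpace.homMk f' fun y =>
    -- Items 0 and 4: a homomorphism is local iff the maximal ideal is the preimage of the maximal
    -- ideal.
    ((IsLocalRing.local_hom_TFAE (f'.hom.stalkMap y).hom).out 0 4).mpr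
      (congrArg PrimeSpectrum.asIdeal (Set.mem_singleton_iff.mp (f.comap_mem y _ rfl)))

theorem map_homOfPrimed {Y Z : LocallyRingedSpace.{u}}
    (f : ofLocallyRingedSpace.obj Y ⟶ ofLocallyRingedSpace.obj Z) :
    ofLocallyRingedSpace.map (homOfPrimed f) = f := rfl

section Lift

variable {X : PrimedRingedSpace.{u}} {Y : LocallyRingedSpace.{u}}
  (f : Y.toSheafedSpace ⟶ X.toSheafedSpace)
  (hf : ∀ y : Y.carrier, PrimeSpectrum.comap (f.hom.stalkMap y).hom
    (IsLocalRing.closedPoint (Y.presheaf.stalk y)) ∈ X.primes (f.hom.base y))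

/-- The point of the localization that is the image of a point of a locally ringed space. -/
abbrev liftPt (y : Y.carrier) : X.LocPoint where
  pt := f.hom.base y
  prime := PrimeSpectrum.comap (f.hom.stalkMap y).hom
    (IsLocalRing.closedPoint (Y.presheaf.stalk y))
  mem := hf y

theorem stalkMap_germ_eq (y : Y.carrier) (U : Opens X.carrier) (h : f.hom.base y ∈ U)
    (s : X.presheaf.obj (op U)) :
    (f.hom.stalkMap y).hom (X.presheaf.germ U (f.hom.base y) h s) =
      Y.presheaf.germ ((Opens.map f.hom.base).obj U) y h (f.hom.c.app (op U) s) :=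
  PresheafedSpace.stalkMap_germ_apply f.hom U y h s

/-- The prime of `liftPt` is the preimage of the maximal ideal, whose elements are by definition the
nonunits. -/
theorem notMem_liftPt_iff (y : Y.carrier) (s : X.presheaf.stalk (f.hom.base y)) :
    s ∉ (liftPt f hf y).prime.asIdeal ↔ IsUnit ((f.hom.stalkMap y).hom s) :=
  not_not

/-- The preimage of the basic open set of `s` is the locus where the pullback of `s` has invertible
germ. -/
theorem continuous_liftPt : Continuous (liftPt f hf) := by
  refine continuous_generateFrom_iff.mpr ?_
  rintro _ ⟨U, s, rfl⟩
  convert! (Y.toRingedSpace.basicOpen (f.hom.c.app (op U) s)).isOpen using 1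
  refine Set.ext fun y => exists_congr fun (h : f.hom.base y ∈ U) => ?_
  refine (notMem_liftPt_iff f hf y _).trans ?_
  rw [stalkMap_germ_eq]

/-- The map from the localized stalk induced by a morphism from a locally ringed space. -/
def liftStalk (y : Y.carrier) : LocStalk (liftPt f hf y) →+* Y.presheaf.stalk y :=
  IsLocalization.lift (M := (liftPt f hf y).prime.asIdeal.primeCompl)
    (g := (f.hom.stalkMap y).hom) fun t => (notMem_liftPt_iff f hf y t.1).mp t.2

theorem liftStalk_algebraMap (y : Y.carrier) (s : X.presheaf.stalk (f.hom.base y)) :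
    liftStalk f hf y (algebraMap _ (LocStalk (liftPt f hf y)) s) = (f.hom.stalkMap y).hom s :=
  IsLocalization.lift_eq _ s

/-- The image of a fraction with the denominator cleared. As the image of `t` is a unit, this
equation determines that value. -/
theorem mul_liftStalk_mk (y : Y.carrier) (a t : X.presheaf.stalk (f.hom.base y))
    (ht : t ∈ (liftPt f hf y).prime.asIdeal.primeCompl) :
    (f.hom.stalkMap y).hom t * liftStalk f hf y (Localization.mk a ⟨t, ht⟩) =
      (f.hom.stalkMap y).hom a := by
  rw [Localization.mk_eq_mk', mul_comm, ← liftStalk_algebraMap f hf, ← liftStalk_algebraMap f hf,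
    ← map_mul]
  exact congrArg _ (IsLocalization.mk'_spec (LocStalk (liftPt f hf y)) a
    (⟨t, ht⟩ : (liftPt f hf y).prime.asIdeal.primeCompl))

/-- If `a / t` becomes a unit, so does `a`; then `a` lies outside the prime and `a / t` was already
invertible. -/
theorem isUnit_of_isUnit_liftStalk (y : Y.carrier) (s : LocStalk (liftPt f hf y))
    (hs : IsUnit (liftStalk f hf y s)) : IsUnit s := by
  induction s using Localization.induction_on with | H p => ?_
  obtain ⟨a, t, ht⟩ := p
  have ha : IsUnit ((f.hom.stalkMap y).hom a) :=
    mul_liftStalk_mk f hf y a t ht ▸ ((notMem_liftPt_iff f hf y t).mp ht).mul hs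
  rw [Localization.mk_eq_mk']
  exact (IsLocalization.AtPrime.isUnit_mk'_iff _ (liftPt f hf y).prime.asIdeal _ _).mpr
    ((notMem_liftPt_iff f hf y a).mpr ha)

/-- The continuous map underlying the lift of a morphism to the localization. -/
def liftBase : Y.carrier ⟶ X.locTop :=
  TopCat.ofHom ⟨liftPt f hf, continuous_liftPt f hf⟩

/-- Where `σ = a / t`, the pullback of `t` has invertible germs, so it is an invertible section. The
quotient of the two pullbacks has the required germs, and these local solutions glue. -/
theorem exists_liftSection (V : Opens X.locTop) (σ : X.locSections V) :
    ∃ s : Y.presheaf.obj (op ((Opens.map (liftBase f hf)).obj V)),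
      ∀ (y : Y.carrier) (hy : y ∈ (Opens.map (liftBase f hf)).obj V),
        Y.presheaf.germ ((Opens.map (liftBase f hf)).obj V) y hy s =
          liftStalk f hf y (σ.1 ⟨liftPt f hf y, hy⟩) := by
  refine Y.toSheafedSpace.exists_germ_eq_of_locally _
    (fun y hy => liftStalk f hf y (σ.1 ⟨liftPt f hf y, hy⟩)) fun y hy => ?_
  obtain ⟨W, hW, i, U, a, t, H⟩ := σ.2 ⟨liftPt f hf y, hy⟩
  let W' : Opens Y.carrier := (Opens.map (liftBase f hf)).obj W
  have hWU : W' ≤ (Opens.map f.hom.base).obj U := fun z hz => (H ⟨liftPt f hf z, hz⟩).1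
  let r := Y.presheaf.map (homOfLE hWU).op
  have hr (s) (z : Y.carrier) (hz : z ∈ W') :
      Y.presheaf.germ W' z hz (r (f.hom.c.app (op U) s)) =
        (f.hom.stalkMap z).hom (X.presheaf.germ U (f.hom.base z) (hWU hz) s) := by
    refine Eq.trans ?_ (stalkMap_germ_eq f z U (hWU hz) s).symm
    exact TopCat.Presheaf.germ_res_apply Y.presheaf (homOfLE hWU) z hz _
  have hu : IsUnit (r (f.hom.c.app (op U) t)) :=
    RingedSpace.isUnit_of_isUnit_germ Y.toRingedSpace W' _ fun z hz => by
      obtain ⟨h, n, e⟩ := H ⟨liftPt f hf z, hz⟩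
      exact (congrArg IsUnit (hr t z hz)).mpr ((notMem_liftPt_iff f hf z _).mp n)
  obtain ⟨v, hv⟩ := hu.exists_right_inv
  refine ⟨W', hW, fun z hz => i.le hz, r (f.hom.c.app (op U) a) * v, fun z hz => ?_⟩
  obtain ⟨h, n, e⟩ := H ⟨liftPt f hf z, hz⟩
  have e' : σ.1 ⟨liftPt f hf z, i.le hz⟩ = _ := e
  refine ((notMem_liftPt_iff f hf z _).mp n).mul_left_cancel ?_
  refine Eq.trans ?_ ((congrArg (fun s => _ * liftStalk f hf z s) e').trans
    (mul_liftStalk_mk f hf z _ _ n)).symm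
  have hv' := congrArg (Y.presheaf.germ W' z hz) hv
  rw [map_mul, map_one, hr] at hv'
  rw [map_mul, hr, mul_left_comm]
  exact (congrArg _ hv').trans (mul_one _)

/-- The pullback of a section of the localization. -/
def liftSection (V : Opens X.locTop) (σ : X.locSections V) :
    Y.presheaf.obj (op ((Opens.map (liftBase f hf)).obj V)) :=
  (exists_liftSection f hf V σ).choose

theorem germ_liftSection (V : Opens X.locTop) (σ : X.locSections V) (y : Y.carrier)
    (hy : y ∈ (Opens.map (liftBase f hf)).obj V) :
    Y.presheaf.germ ((Opens.map (liftBase f hf)).obj V) y hy (liftSection f hf V σ) =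
      liftStalk f hf y (σ.1 ⟨liftPt f hf y, hy⟩) :=
  (exists_liftSection f hf V σ).choose_spec y hy

/-- The pullback of sections of the localization as a ring homomorphism. -/
def liftSectionHom (V : Opens X.locTop) :
    X.locSections V →+* Y.presheaf.obj (op ((Opens.map (liftBase f hf)).obj V)) where
  toFun := liftSection f hf V
  map_one' := Y.toSheafedSpace.section_ext fun y hy =>
    (germ_liftSection f hf _ _ y hy).trans ((map_one _).trans (map_one _).symm)
  map_mul' σ τ := Y.toSheafedSpace.section_ext fun y hy => by
    rw [map_mul]
    simp only [germ_liftSection]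
    exact map_mul _ _ _
  map_zero' := Y.toSheafedSpace.section_ext fun y hy =>
    (germ_liftSection f hf _ _ y hy).trans ((map_zero _).trans (map_zero _).symm)
  map_add' σ τ := Y.toSheafedSpace.section_ext fun y hy => by
    rw [map_add]
    simp only [germ_liftSection]
    exact map_add _ _ _

/-- The lift of a morphism to the localization, as a morphism of ringed spaces. -/
def liftHom : Y.toSheafedSpace ⟶ X.loc.toSheafedSpace :=
  InducedCategory.homMk
    { base := liftBase f hf
      c :=
        { app := fun V => CommRingCat.ofHom (liftSectionHom f hf V.unop)
          naturality := fun V W i => by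
            ext σ
            refine Y.toSheafedSpace.section_ext fun y hy => ?_
            refine (germ_liftSection f hf _ _ y hy).trans ?_
            refine Eq.trans ?_ (TopCat.Presheaf.germ_res_apply Y.presheaf
              ((Opens.map (liftBase f hf)).map i.unop) y hy (liftSection f hf V.unop σ)).symm
            exact (germ_liftSection f hf V.unop σ y (i.unop.le hy)).symm } }

/-- Both factors, evaluation and `liftStalk`, reflect units, which makes the lift local. -/
theorem stalkMap_liftHom (y : Y.carrier)
    (s : ↑(X.locPresheaf.stalk (X := X.locTop) (liftPt f hf y))) :
    ((liftHom f hf).hom.stalkMap y).hom s =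
      liftStalk f hf y ((X.locStalkHom (liftPt f hf y)).hom s) := by
  obtain ⟨V, hV, σ, rfl⟩ := TopCat.Presheaf.exists_germ_eq X.locPresheaf s
  refine (PresheafedSpace.stalkMap_germ_apply (liftHom f hf).hom V y hV σ).trans ?_
  refine Eq.trans ?_ (congrArg (liftStalk f hf y) (X.locStalkHom_germ _ V hV σ)).symm
  exact germ_liftSection f hf V σ y hV

/-- The lift of a morphism from a locally ringed space to the localization. -/
def lift : Y ⟶ X.loc :=
  LocallyRingedSpace.homMk (liftHom f hf) fun y => ⟨fun s hs => by
    have hs' : IsUnit (liftStalk f hf y ((X.locStalkHom (liftPt f hf y)).hom s)) :=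
      (congrArg IsUnit (stalkMap_liftHom f hf y s)).mp hs
    exact (X.isLocalHom_locStalkHom (liftPt f hf y)).map_nonunit s
      (isUnit_of_isUnit_liftStalk f hf y _ hs')⟩

theorem lift_locπHom : (lift f hf).toShHom ≫ X.locπHom = f := by
  refine SheafedSpace.hom_ext_germ rfl fun V s y hy _ => ?_
  refine (germ_liftSection f hf ((Opens.map X.locπHom.hom.base).obj V) _ y hy).trans ?_
  refine (liftStalk_algebraMap f hf y _).trans ?_
  exact stalkMap_germ_eq f y V hy s

variable {f}

/-- The first coordinate of `g y` is `f y`. For the second, `g` is local, so the maximal ideal at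
`y` pulls back to the one at `g y`, which lies over the prime of `g y` by `comap_locπHom`. -/
theorem base_eq_liftPt {g : Y ⟶ X.loc} (hg : g.toShHom ≫ X.locπHom = f) (y : Y.carrier) :
    g.base y = liftPt f hf y := by
  subst hg
  let p : X.LocPoint := g.base y
  have h₁ : PrimeSpectrum.comap (g.stalkMap y).hom
      (IsLocalRing.closedPoint (Y.presheaf.stalk y)) =
      IsLocalRing.closedPoint (X.loc.presheaf.stalk p) :=
    IsLocalRing.comap_closedPoint (g.stalkMap y).hom
  have h₂ : (g.toShHom ≫ X.locπHom).hom.stalkMap y =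
      X.locπHom.hom.stalkMap p ≫ g.stalkMap y :=
    PresheafedSpace.stalkMap.comp g.toShHom.hom X.locπHom.hom y
  have h : PrimeSpectrum.comap ((g.toShHom ≫ X.locπHom).hom.stalkMap y).hom
      (IsLocalRing.closedPoint (Y.presheaf.stalk y)) = p.prime := by
    rw [← X.comap_locπHom p, ← h₁, h₂]
    rfl
  have hp (q : X.LocPoint) (z) (hz : z = q.prime) (hm) : q = ⟨q.pt, z, hm⟩ := by subst hz; rfl
  exact hp p _ h _

/-- Near the point `t * σ = a` with `a` and `t` coming from `X`. The effect of `g` on those is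
prescribed by `f`, and `t` becomes a unit, so the effect on `σ` is forced. -/
theorem germ_c_app_eq_liftStalk {g : Y ⟶ X.loc} (hg : g.toShHom ≫ X.locπHom = f)
    (V : Opens X.locTop) (σ : X.locSections V) (y : Y.carrier) (hy : g.base y ∈ V)
    (hy' : liftPt f hf y ∈ V) :
    Y.presheaf.germ ((Opens.map g.base).obj V) y hy (g.c.app (op V) σ) =
      liftStalk f hf y (σ.1 ⟨liftPt f hf y, hy'⟩) := by
  obtain ⟨W, hW, i, U, a, t, H⟩ := σ.2 ⟨liftPt f hf y, hy'⟩
  obtain ⟨h, n, e⟩ := H ⟨liftPt f hf y, hW⟩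
  have e' : σ.1 ⟨liftPt f hf y, i.le hW⟩ = _ := e
  refine ((notMem_liftPt_iff f hf y _).mp n).mul_left_cancel ?_
  refine Eq.trans ?_ ((congrArg (fun s => _ * liftStalk f hf y s) e').trans
    (mul_liftStalk_mk f hf y _ _ n)).symm
  have hW' : g.base y ∈ W := (base_eq_liftPt hf hg y).symm ▸ hW
  subst hg
  have key (s : X.presheaf.obj (op U)) : ((g.toShHom ≫ X.locπHom).hom.stalkMap y).hom
      (X.presheaf.germ U _ h s) = (g.stalkMap y).hom (X.loc.presheaf.germ
        ((Opens.map X.locπHom.hom.base).obj U) (g.base y) h (X.locπHom.hom.c.app (op U) s)) := by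
    rw [stalkMap_germ_eq]
    exact (PresheafedSpace.stalkMap_germ_apply g.toHom
      ((Opens.map X.locπHom.hom.base).obj U) y h _).symm
  refine (congrArg₂ (· * ·) (key t)
    (PresheafedSpace.stalkMap_germ_apply g.toHom V y hy σ).symm).trans ?_
  refine Eq.trans ?_ (key a).symm
  refine (map_mul (g.stalkMap y).hom _ _).symm.trans (congrArg _ ?_)
  -- It remains to compare germs at `g y`; the equation `t * σ = a` already holds for the sections
  -- over `W`.
  let p : X.LocPoint := g.base y
  let U' : Opens X.locTop := (Opens.map X.locπHom.hom.base).obj U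
  have hWU : W ≤ U' := fun q hq => (H ⟨q, hq⟩).1
  have r₁ (s) : X.locPresheaf.germ W p hW' (X.locPresheaf.map (homOfLE hWU).op s) =
    X.locPresheaf.germ U' p h s := TopCat.Presheaf.germ_res_apply ..
  have r₂ : X.locPresheaf.germ W p hW' (X.locPresheaf.map i.op σ) =
    X.locPresheaf.germ V p hy σ := TopCat.Presheaf.germ_res_apply ..
  refine (congrArg₂ (· * ·) (r₁ _) r₂).symm.trans (Eq.trans ?_ (r₁ _))
  refine (map_mul _ _ _).symm.trans (congrArg _ ?_)
  refine Subtype.ext (funext fun q => ?_)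
  obtain ⟨h', n', e''⟩ := H q
  refine (congrArg₂ (· * ·) (Localization.mk_one_eq_algebraMap _).symm e'').trans ?_
  refine (Localization.mk_mul ..).trans ?_
  refine Eq.trans ?_ (Localization.mk_one_eq_algebraMap _)
  refine Localization.mk_eq_mk_iff.mpr (Localization.r_iff_exists.mpr ⟨1, ?_⟩)
  simp

theorem hom_ext_locπHom
    (hf : ∀ y : Y.carrier, PrimeSpectrum.comap (f.hom.stalkMap y).hom
      (IsLocalRing.closedPoint (Y.presheaf.stalk y)) ∈ X.primes (f.hom.base y))
    {g g' : Y ⟶ X.loc} (hg : g.toShHom ≫ X.locπHom = f)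
    (hg' : g'.toShHom ≫ X.locπHom = f) : g = g' := by
  have hb (y : Y.carrier) := base_eq_liftPt hf hg y
  refine LocallyRingedSpace.forgetToSheafedSpace.map_injective (SheafedSpace.hom_ext_germ ?_ ?_)
  · ext y
    exact (hb y).trans (base_eq_liftPt hf hg' y).symm
  · intro V σ y hy hy'
    have h : liftPt f hf y ∈ V := hb y ▸ hy
    exact (germ_c_app_eq_liftStalk hf hg V σ y hy h).trans
      (germ_c_app_eq_liftStalk hf hg' V σ y hy' h).symm

end Lift

/-- The localization is universal among the locally ringed spaces over a primed ringed space. -/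
theorem existsUnique_lift {X : PrimedRingedSpace.{u}} {Y : LocallyRingedSpace.{u}}
    (f : ofLocallyRingedSpace.obj Y ⟶ X) :
    ∃! g : Y ⟶ X.loc, ofLocallyRingedSpace.map g ≫ X.locπ = f := by
  have hf := fun y => f.comap_mem y _ rfl
  exact ⟨lift f.toHom hf, Hom.ext (lift_locπHom f.toHom hf), fun g hg =>
    hom_ext_locπHom hf (congrArg Hom.toHom hg) (lift_locπHom f.toHom hf)⟩

/-- If a cone of locally ringed spaces over primed ringed spaces is a limit, the localization of
its point is a limit of locally ringed spaces. -/
def isLimitLoc {J : Type*} [Category* J] {F : J ⥤ LocallyRingedSpace.{u}}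
    {c : Cone (F ⋙ ofLocallyRingedSpace)} (hc : IsLimit c)
    (p : (Functor.const J).obj c.pt.loc ⟶ F)
    (hp : ∀ j : J, ofLocallyRingedSpace.map (p.app j) = c.pt.locπ ≫ c.π.app j) :
    IsLimit (Cone.mk c.pt.loc p) where
  lift s := (existsUnique_lift (hc.lift (ofLocallyRingedSpace.mapCone s))).choose
  fac s j := ofLocallyRingedSpace_map_injective <| by
    rw [Functor.map_comp, hp]
    refine (Category.assoc _ _ _).symm.trans ?_
    exact (congrArg (· ≫ c.π.app j) (existsUnique_lift _).choose_spec.1).trans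
      (hc.fac (ofLocallyRingedSpace.mapCone s) j)
  uniq s m hm := (existsUnique_lift (hc.lift (ofLocallyRingedSpace.mapCone s))).choose_spec.2 m <|
    hc.uniq (ofLocallyRingedSpace.mapCone s) _ fun j => by
      rw [Category.assoc, ← hp, ← Functor.map_comp]
      exact congrArg ofLocallyRingedSpace.map (hm j)

/-- The composites run between spaces with local prime systems, hence are local; naturality is
checked after the faithful functor. -/
theorem exists_locCone {J : Type*} [Category* J] {F : J ⥤ LocallyRingedSpace.{u}}
    (c : Cone (F ⋙ ofLocallyRingedSpace)) :
    ∃ p : (Functor.const J).obj c.pt.loc ⟶ F,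
      ∀ j : J, ofLocallyRingedSpace.map (p.app j) = c.pt.locπ ≫ c.π.app j :=
  ⟨{ app := fun j => homOfPrimed (c.pt.locπ ≫ c.π.app j)
     naturality := fun i j φ => ofLocallyRingedSpace_map_injective <| by
      rw [Functor.map_comp, Functor.map_comp, map_homOfPrimed, map_homOfPrimed, Category.assoc]
      exact (congrArg (· ≫ _) (ofLocallyRingedSpace.map_id _)).trans
        ((Category.id_comp _).trans (congrArg (c.pt.locπ ≫ ·) (c.w φ).symm)) }, fun _ => rfl⟩

end PrimedRingedSpace
end AlgebraicGeometry

/-! ### Limits of ringed spaces. -/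

namespace AlgebraicGeometry
namespace SheafedSpace

variable {J : Type u} [SmallCategory J] {F : J ⥤ SheafedSpace CommRingCat.{u}}

/-- The components of a cone over the underlying topological spaces. -/
def topProj (T : Cone (F ⋙ forget _)) (j : J) : T.pt ⟶ (F.obj j).carrier :=
  T.π.app j

theorem topProj_comp (T : Cone (F ⋙ forget _)) {i j : J} (φ : i ⟶ j) :
    topProj T i ≫ (F.map φ).hom.base = topProj T j :=
  T.w φ

variable (T : Cone (F ⋙ forget _))

/-- Compatible ring homomorphisms to `R` from the sections of the sheaves `F j` over open sets
whose preimage contains `U`. -/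
structure CompatibleHoms (U : Opens T.pt) (R : Type u) [CommRing R] where
  /-- The family of homomorphisms. -/
  hom (j : J) (V : Opens (F.obj j).carrier) (h : U ≤ (Opens.map (topProj T j)).obj V) :
    (F.obj j).presheaf.obj (op V) →+* R
  res (j : J) (V V' : Opens (F.obj j).carrier) (i : V' ⟶ V)
    (h : U ≤ (Opens.map (topProj T j)).obj V) (h' : U ≤ (Opens.map (topProj T j)).obj V')
    (s : (F.obj j).presheaf.obj (op V)) :
    hom j V' h' ((F.obj j).presheaf.map i.op s) = hom j V h s
  map (i j : J) (φ : i ⟶ j) (V : Opens (F.obj j).carrier)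
    (h : U ≤ (Opens.map (topProj T j)).obj V)
    (h' : U ≤ (Opens.map (topProj T i)).obj ((Opens.map (F.map φ).hom.base).obj V))
    (s : (F.obj j).presheaf.obj (op V)) :
    hom i _ h' ((F.map φ).hom.c.app (op V) s) = hom j V h s

/-- Generators of the ring that is universal for compatible homomorphisms. -/
structure LimGen (U : Opens T.pt) : Type u where
  /-- The index. -/
  j : J
  /-- The open set. -/
  V : Opens (F.obj j).carrier
  le : U ≤ (Opens.map (topProj T j)).obj V
  /-- The section. -/
  s : (F.obj j).presheaf.obj (op V)

variable {T} in
/-- The evaluation of polynomials in the generators at compatible homomorphisms. -/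
def CompatibleHoms.eval {U : Opens T.pt} {R : Type u} [CommRing R] (φ : CompatibleHoms T U R) :
    MvPolynomial (LimGen T U) ℤ →+* R :=
  MvPolynomial.eval₂Hom (Int.castRingHom R) fun g => φ.hom g.j g.V g.le g.s

variable {T} in
@[simp]
theorem CompatibleHoms.eval_X {U : Opens T.pt} {R : Type u} [CommRing R]
    (φ : CompatibleHoms T U R) (g : LimGen T U) :
    φ.eval (MvPolynomial.X g) = φ.hom g.j g.V g.le g.s :=
  MvPolynomial.eval₂Hom_X' ..

/-- The polynomials in the generators that vanish under all compatible homomorphisms. -/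
def limIdeal (U : Opens T.pt) : Ideal (MvPolynomial (LimGen T U) ℤ) where
  -- This replaces an explicit list of relations. The generators lie in `Type u`, so the quotient is
  -- itself an admissible `R`.
  carrier := {x | ∀ (R : Type u) [CommRing R] (φ : CompatibleHoms T U R), φ.eval x = 0}
  zero_mem' _ _ _ := map_zero _
  add_mem' hx hy R _ φ := by rw [map_add, hx R φ, hy R φ, add_zero]
  smul_mem' a x hx R _ φ := by rw [smul_eq_mul, map_mul, hx R φ, mul_zero]

/-- The ring that is universal for compatible homomorphisms. -/
abbrev LimRing (U : Opens T.pt) : Type u :=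
  MvPolynomial (LimGen T U) ℤ ⧸ limIdeal T U

theorem LimRing.mk_eq_mk {U : Opens T.pt} {x y : MvPolynomial (LimGen T U) ℤ}
    (h : ∀ (R : Type u) [CommRing R] (φ : CompatibleHoms T U R), φ.eval x = φ.eval y) :
    Ideal.Quotient.mk (limIdeal T U) x = Ideal.Quotient.mk (limIdeal T U) y :=
  Ideal.Quotient.eq.mpr fun R _ φ => by rw [map_sub, h R φ, sub_self]

/-- The universal compatible homomorphisms. -/
def univHoms (U : Opens T.pt) : CompatibleHoms T U (LimRing T U) where
  hom j V h :=
    { toFun := fun s => Ideal.Quotient.mk _ (MvPolynomial.X ⟨j, V, h, s⟩)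
      map_one' := by
        rw [← map_one (Ideal.Quotient.mk (limIdeal T U))]
        exact LimRing.mk_eq_mk T fun R _ φ => by simp
      map_mul' := fun s t => by
        rw [← map_mul]
        exact LimRing.mk_eq_mk T fun R _ φ => by simp
      map_zero' := by
        rw [← map_zero (Ideal.Quotient.mk (limIdeal T U))]
        exact LimRing.mk_eq_mk T fun R _ φ => by simp
      map_add' := fun s t => by
        rw [← map_add]
        exact LimRing.mk_eq_mk T fun R _ φ => by simp }
  res j V V' i h h' s := LimRing.mk_eq_mk T fun R _ φ => by
    simpa using φ.res j V V' i h h' s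
  map i j f V h h' s := LimRing.mk_eq_mk T fun R _ φ => by
    simpa using φ.map i j f V h h' s

variable {T}

/-- The ring homomorphism induced by compatible homomorphisms. -/
def LimRing.desc {U : Opens T.pt} {R : Type u} [CommRing R] (φ : CompatibleHoms T U R) :
    LimRing T U →+* R :=
  Ideal.Quotient.lift _ φ.eval fun _ hx => hx R φ

@[simp]
theorem LimRing.desc_univHoms {U : Opens T.pt} {R : Type u} [CommRing R]
    (φ : CompatibleHoms T U R) (j : J) (V : Opens (F.obj j).carrier)
    (h : U ≤ (Opens.map (topProj T j)).obj V) (s : (F.obj j).presheaf.obj (op V)) :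
    LimRing.desc φ ((univHoms T U).hom j V h s) = φ.hom j V h s :=
  (Ideal.Quotient.lift_mk ..).trans (φ.eval_X _)

theorem LimRing.hom_ext {U : Opens T.pt} {R : Type u} [CommRing R] {f g : LimRing T U →+* R}
    (H : ∀ (j : J) (V : Opens (F.obj j).carrier) (h : U ≤ (Opens.map (topProj T j)).obj V)
      (s : (F.obj j).presheaf.obj (op V)),
      f ((univHoms T U).hom j V h s) = g ((univHoms T U).hom j V h s)) : f = g :=
  Ideal.Quotient.ringHom_ext (MvPolynomial.ringHom_ext (fun n => by simp)
    fun x => H x.j x.V x.le x.s)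

/-- Compatible homomorphisms for a smaller open set are compatible for a larger one. -/
def CompatibleHoms.ofLE {U U' : Opens T.pt} (hU : U' ≤ U) {R : Type u} [CommRing R]
    (φ : CompatibleHoms T U' R) : CompatibleHoms T U R where
  hom j V h := φ.hom j V (hU.trans h)
  res j V V' i _ _ s := φ.res j V V' i _ _ s
  map i j f V _ _ s := φ.map i j f V _ _ s

variable (T)

/-- The presheaf of rings on the point of a cone of topological spaces that is universal for
compatible homomorphisms. -/
def limPresheaf : TopCat.Presheaf CommRingCat.{u} T.pt where
  obj U := CommRingCat.of (LimRing T U.unop)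
  map i := CommRingCat.ofHom (LimRing.desc ((univHoms T _).ofLE i.unop.le))
  map_id U := CommRingCat.hom_ext (LimRing.hom_ext fun j V h s => LimRing.desc_univHoms ..)
  map_comp {U U' U''} i i' := CommRingCat.hom_ext (LimRing.hom_ext fun j V h s => by
    have h₁ := LimRing.desc_univHoms ((univHoms T U'.unop).ofLE i.unop.le) j V h s
    have h₂ := LimRing.desc_univHoms ((univHoms T U''.unop).ofLE i'.unop.le) j V
      (i.unop.le.trans h) s
    exact (LimRing.desc_univHoms ..).trans ((congrArg
      (LimRing.desc ((univHoms T U''.unop).ofLE i'.unop.le)) h₁).trans h₂).symm)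

/-- The ringed space over the point of a cone of topological spaces that carries the universal
sheaf. -/
def limSpace : SheafedSpace CommRingCat.{u} where
  carrier := T.pt
  presheaf := sheafify (Opens.grothendieckTopology T.pt) (limPresheaf T)
  IsSheaf := ((presheafToSheaf (Opens.grothendieckTopology T.pt) _).obj (limPresheaf T)).property

/-- The pullback to the universal ringed space of a section of one of the sheaves. -/
def limSection (U : Opens T.pt) (j : J) (V : Opens (F.obj j).carrier)
    (h : U ≤ (Opens.map (topProj T j)).obj V) :
    (F.obj j).presheaf.obj (op V) →+* (limSpace T).presheaf.obj (op U) :=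
  ((toSheafify (Opens.grothendieckTopology T.pt) (limPresheaf T)).app (op U)).hom.comp
    ((univHoms T U).hom j V h)

theorem map_limSection {U U' : Opens T.pt} (i : U' ⟶ U) (j : J) (V : Opens (F.obj j).carrier)
    (h : U ≤ (Opens.map (topProj T j)).obj V) (h' : U' ≤ (Opens.map (topProj T j)).obj V)
    (s : (F.obj j).presheaf.obj (op V)) :
    (limSpace T).presheaf.map i.op (limSection T U j V h s) = limSection T U' j V h' s := by
  refine (ConcreteCategory.congr_hom ((toSheafify (Opens.grothendieckTopology T.pt)
    (limPresheaf T)).naturality i.op) ((univHoms T U).hom j V h s)).symm.trans ?_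
  exact congrArg ((toSheafify (Opens.grothendieckTopology T.pt) (limPresheaf T)).app
    (op U')).hom (LimRing.desc_univHoms ..)

theorem germ_limSection {U U' : Opens T.pt} (j : J) (V : Opens (F.obj j).carrier)
    (h : U ≤ (Opens.map (topProj T j)).obj V) (h' : U' ≤ (Opens.map (topProj T j)).obj V)
    (s : (F.obj j).presheaf.obj (op V)) (x : (limSpace T).carrier) (hx : x ∈ U) (hx' : x ∈ U') :
    (limSpace T).presheaf.germ U x hx (limSection T U j V h s) =
      (limSpace T).presheaf.germ U' x hx' (limSection T U' j V h' s) :=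
  TopCat.Presheaf.germ_ext (limSpace T).presheaf (U ⊓ U') ⟨hx, hx'⟩
    (Opens.infLELeft U U') (Opens.infLERight U U')
    ((map_limSection T _ j V h (inf_le_left.trans h) s).trans
      (map_limSection T _ j V h' (inf_le_left.trans h) s).symm)

/-- The projections from the universal ringed space. -/
def limProj (j : J) : limSpace T ⟶ F.obj j :=
  InducedCategory.homMk
    { base := topProj T j
      c :=
        { app := fun V => CommRingCat.ofHom (limSection T _ j V.unop le_rfl)
          naturality := fun V V' i => by
            ext s
            refine Eq.trans ?_ (map_limSection T ((Opens.map (topProj T j)).map i.unop) j V.unop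
              le_rfl (fun x hx => i.unop.le hx) s).symm
            exact congrArg ((toSheafify (Opens.grothendieckTopology T.pt) (limPresheaf T)).app
              (op ((Opens.map (topProj T j)).obj V'.unop))).hom
              ((univHoms T _).res j V.unop V'.unop i.unop _ _ s) } }

/-- The universal ringed space as a cone. -/
def limCone : Cone F where
  pt := limSpace T
  π :=
    { app := limProj T
      naturality := fun i j φ => by
        refine (Category.id_comp _).trans (SheafedSpace.hom_ext_germ (topProj_comp T φ).symm ?_)
        intro V s x hx hx'
        have h : (Opens.map (topProj T i)).obj ((Opens.map (F.map φ).hom.base).obj V) ≤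
            (Opens.map (topProj T j)).obj V := by
          rw [← topProj_comp T φ]; rfl
        refine (germ_limSection T j V le_rfl h s x hx hx').trans ?_
        exact congrArg (fun t => (limSpace T).presheaf.germ _ x hx'
          ((toSheafify (Opens.grothendieckTopology T.pt) (limPresheaf T)).app _ t))
          ((univHoms T _).map i j φ V h le_rfl s).symm }

/-- The section over `U` is restricted from the whole preimage of `V`, where it is the pullback
along `limProj`. Hence composites with the projections determine `m` on generators. -/
theorem germ_c_limSection {Y : SheafedSpace CommRingCat.{u}} (m : Y ⟶ limSpace T)
    (U : Opens T.pt) (j : J) (V : Opens (F.obj j).carrier)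
    (h : U ≤ (Opens.map (topProj T j)).obj V) (s : (F.obj j).presheaf.obj (op V))
    (y : Y.carrier) (hy : m.hom.base y ∈ U) :
    Y.presheaf.germ ((Opens.map m.hom.base).obj U) y hy
        (m.hom.c.app (op U) (limSection T U j V h s)) =
      Y.presheaf.germ ((Opens.map (m ≫ limProj T j).hom.base).obj V) y (h hy)
        ((m ≫ limProj T j).hom.c.app (op V) s) := by
  have h₁ := map_limSection T (homOfLE h) j V le_rfl h s
  have h₂ := ConcreteCategory.congr_hom (m.hom.c.naturality (homOfLE h).op)
    (limSection T ((Opens.map (topProj T j)).obj V) j V le_rfl s)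
  refine (congrArg (fun t => Y.presheaf.germ ((Opens.map m.hom.base).obj U) y hy
    (m.hom.c.app (op U) t)) h₁.symm).trans ?_
  refine (congrArg (Y.presheaf.germ ((Opens.map m.hom.base).obj U) y hy) h₂).trans ?_
  exact TopCat.Presheaf.germ_res_apply Y.presheaf
    ((Opens.map m.hom.base).map (homOfLE h)) y hy _

theorem germ_c_congr {Y Z : SheafedSpace CommRingCat.{u}} {f g : Y ⟶ Z} (h : f = g)
    (V : Opens Z.carrier) (s : Z.presheaf.obj (op V)) (y : Y.carrier)
    (hf : f.hom.base y ∈ V) (hg : g.hom.base y ∈ V) :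
    Y.presheaf.germ ((Opens.map f.hom.base).obj V) y hf (f.hom.c.app (op V) s) =
      Y.presheaf.germ ((Opens.map g.hom.base).obj V) y hg (g.hom.c.app (op V) s) := by
  subst h; rfl

variable {T}

theorem limSpace_hom_ext (hT : IsLimit T) {Y : SheafedSpace CommRingCat.{u}}
    {m m' : Y ⟶ limSpace T} (h : ∀ j, m ≫ limProj T j = m' ≫ limProj T j) : m = m' := by
  have hb : m.hom.base = m'.hom.base := hT.hom_ext fun j => congrArg (fun f => f.hom.base) (h j)
  obtain ⟨⟨b, c⟩⟩ := m
  obtain ⟨⟨b', c'⟩⟩ := m'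
  obtain rfl : b = b' := hb
  obtain rfl : c = c' := by
    -- The target is a sheaf, so it suffices to compare on the presheaf, and there on the generators
    -- of `LimRing`.
    refine sheafify_hom_ext _ _ _ (TopCat.Sheaf.pushforward_sheaf_of_sheaf b Y.IsSheaf) ?_
    refine NatTrans.ext (funext fun U => CommRingCat.hom_ext (LimRing.hom_ext fun j V hV s => ?_))
    refine Y.section_ext fun y hy => ?_
    refine (germ_c_limSection T ⟨⟨b, c⟩⟩ U.unop j V hV s y hy).trans
      (Eq.trans ?_ (germ_c_limSection T ⟨⟨b, c'⟩⟩ U.unop j V hV s y hy).symm)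
    exact germ_c_congr (h j) V s y (hV hy) (hV hy)
  rfl

section Lift

variable (hT : IsLimit T) (s : Cone F)

/-- The continuous map underlying the lift of a cone. -/
def limLiftBase : s.pt.carrier ⟶ T.pt :=
  hT.lift ((forget _).mapCone s)

theorem limLiftBase_comp (j : J) :
    limLiftBase hT s ≫ topProj T j = (s.π.app j).hom.base :=
  hT.fac ((forget _).mapCone s) j

theorem map_limLiftBase_le {U : Opens T.pt} {j : J} {V : Opens (F.obj j).carrier}
    (h : U ≤ (Opens.map (topProj T j)).obj V) :
    (Opens.map (limLiftBase hT s)).obj U ≤ (Opens.map (s.π.app j).hom.base).obj V := by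
  rw [← limLiftBase_comp hT s]
  exact fun y hy => h hy

/-- The pullback of sections along the components of a cone. -/
def coneSection {U : Opens T.pt} {j : J} {V : Opens (F.obj j).carrier}
    (h : U ≤ (Opens.map (topProj T j)).obj V) :
    (F.obj j).presheaf.obj (op V) →+*
      s.pt.presheaf.obj (op ((Opens.map (limLiftBase hT s)).obj U)) :=
  (s.pt.presheaf.map (homOfLE (map_limLiftBase_le hT s h)).op).hom.comp
    ((s.π.app j).hom.c.app (op V)).hom

theorem germ_coneSection {U : Opens T.pt} {j : J} {V : Opens (F.obj j).carrier}
    (h : U ≤ (Opens.map (topProj T j)).obj V) (t : (F.obj j).presheaf.obj (op V))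
    (y : s.pt.carrier) (hy : y ∈ (Opens.map (limLiftBase hT s)).obj U) :
    s.pt.presheaf.germ ((Opens.map (limLiftBase hT s)).obj U) y hy (coneSection hT s h t) =
      s.pt.presheaf.germ ((Opens.map (s.π.app j).hom.base).obj V) y
        (map_limLiftBase_le hT s h hy) ((s.π.app j).hom.c.app (op V) t) :=
  TopCat.Presheaf.germ_res_apply s.pt.presheaf (homOfLE (map_limLiftBase_le hT s h)) y hy _

/-- The pullback of sections along a cone is compatible. -/
def coneHoms (U : Opens T.pt) :
    CompatibleHoms T U (s.pt.presheaf.obj (op ((Opens.map (limLiftBase hT s)).obj U))) where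
  hom j V h := coneSection hT s h
  res j V V' i h h' t := s.pt.section_ext fun y hy => by
    rw [germ_coneSection, germ_coneSection]
    refine (congrArg (s.pt.presheaf.germ _ y _) (ConcreteCategory.congr_hom
      ((s.π.app j).hom.c.naturality i.op) t)).trans ?_
    exact TopCat.Presheaf.germ_res_apply s.pt.presheaf
      ((Opens.map (s.π.app j).hom.base).map i) y _ _
  map i j φ V h h' t := s.pt.section_ext fun y hy => by
    rw [germ_coneSection, germ_coneSection]
    exact germ_c_congr (s.w φ) V t y (map_limLiftBase_le hT s h' hy)
      (map_limLiftBase_le hT s h hy)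

/-- The morphism of presheaves underlying the lift of a cone. -/
def limLiftPresheaf : limPresheaf T ⟶
    (TopCat.Presheaf.pushforward CommRingCat (limLiftBase hT s)).obj s.pt.presheaf where
  app U := CommRingCat.ofHom (LimRing.desc (coneHoms hT s U.unop))
  naturality U U' i := CommRingCat.hom_ext (LimRing.hom_ext fun j V h t => by
    refine (congrArg (LimRing.desc _) (LimRing.desc_univHoms ..)).trans ?_
    refine (LimRing.desc_univHoms ..).trans ?_
    refine Eq.trans ?_ (congrArg
      (s.pt.presheaf.map ((Opens.map (limLiftBase hT s)).map i.unop).op).hom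
      (LimRing.desc_univHoms ..)).symm
    refine s.pt.section_ext fun y hy => ?_
    refine (germ_coneSection hT s (i.unop.le.trans h) t y hy).trans ?_
    refine Eq.trans ?_ (TopCat.Presheaf.germ_res_apply s.pt.presheaf
      ((Opens.map (limLiftBase hT s)).map i.unop) y hy _).symm
    exact (germ_coneSection hT s h t y _).symm)

/-- The lift of a cone to the universal ringed space. -/
def limLift : s.pt ⟶ limSpace T :=
  InducedCategory.homMk
    { base := limLiftBase hT s
      c := sheafifyLift _ (limLiftPresheaf hT s)
        (TopCat.Sheaf.pushforward_sheaf_of_sheaf _ s.pt.IsSheaf) }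

theorem limLift_limProj (j : J) : limLift hT s ≫ limProj T j = s.π.app j := by
  refine hom_ext_germ (limLiftBase_comp hT s j) fun V t y hy hy' => ?_
  -- Sections in the image of the presheaf are sent where `limLiftPresheaf` sends them, and on
  -- generators that is `coneSection`.
  have h : ((sheafifyLift _ (limLiftPresheaf hT s)
      (TopCat.Sheaf.pushforward_sheaf_of_sheaf _ s.pt.IsSheaf)).app
      (op ((Opens.map (topProj T j)).obj V))).hom (limSection T _ j V le_rfl t) =
      coneSection hT s le_rfl t := by
    refine (ConcreteCategory.congr_hom (NatTrans.congr_app (toSheafify_sheafifyLift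
      (Opens.grothendieckTopology T.pt) (limLiftPresheaf hT s)
      (TopCat.Sheaf.pushforward_sheaf_of_sheaf _ s.pt.IsSheaf))
      (op ((Opens.map (topProj T j)).obj V))) _).trans ?_
    exact LimRing.desc_univHoms ..
  refine (congrArg (s.pt.presheaf.germ _ y hy) h).trans ?_
  exact germ_coneSection hT s le_rfl t y hy

/-- The universal ringed space over a limit of topological spaces is a limit. -/
def isLimitLimCone : IsLimit (limCone T) where
  lift s := limLift hT s
  fac s j := limLift_limProj hT s j
  uniq s _ hm := limSpace_hom_ext hT fun j => (hm j).trans (limLift_limProj hT s j).symm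

end Lift

instance hasLimits_commRingCat : HasLimits (SheafedSpace.{u + 1, u, u} CommRingCat.{u}) where
  has_limits_of_shape _ _ :=
    { has_limit := fun F => ⟨limCone _, isLimitLimCone (limit.isLimit (F ⋙ forget _))⟩ }

end SheafedSpace

/-! ### Limits of primed ringed spaces. -/

namespace PrimedRingedSpace

/-- The forgetful functor from primed ringed spaces to ringed spaces. -/
def forgetToSheafedSpace : PrimedRingedSpace.{u} ⥤ SheafedSpace CommRingCat.{u} where
  obj X := X.toSheafedSpace
  map f := f.toHom

variable {J : Type u} [SmallCategory J] {F : J ⥤ PrimedRingedSpace.{u}}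
  (c : Cone (F ⋙ forgetToSheafedSpace))

/-- The components of a cone of ringed spaces under a diagram of primed ringed spaces. -/
def coneProj (j : J) : c.pt ⟶ (F.obj j).toSheafedSpace :=
  c.π.app j

/-- The point of a cone of ringed spaces under a diagram of primed ringed spaces, with the largest
prime system for which the components of the cone are morphisms of primed ringed spaces. -/
def conePt : PrimedRingedSpace.{u} where
  __ := c.pt
  primes x := {z | ∀ j, PrimeSpectrum.comap ((coneProj c j).hom.stalkMap x).hom z ∈
    (F.obj j).primes ((coneProj c j).hom.base x)}

/-- A cone of ringed spaces as a cone of primed ringed spaces. -/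
def primedCone : Cone F where
  pt := conePt c
  π :=
    { app := fun j => ⟨coneProj c j, fun _ _ hz => hz j⟩
      naturality := fun _ _ φ => Hom.ext ((Category.id_comp _).trans (c.w φ).symm) }

/-- The limit of a diagram of primed ringed spaces is the limit of the underlying ringed spaces,
with the largest possible prime system. -/
def isLimitPrimedCone (hc : IsLimit c) : IsLimit (primedCone c) where
  lift s := ⟨hc.lift (forgetToSheafedSpace.mapCone s), fun y z hz j => by
    let l : s.pt.toSheafedSpace ⟶ c.pt := hc.lift (forgetToSheafedSpace.mapCone s)
    have h : l ≫ coneProj c j = (s.π.app j).toHom := hc.fac _ j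
    -- The type of the stalk map depends on the morphism, so the equation `h` is used by
    -- substituting for a variable `f`.
    have key (f : s.pt.toSheafedSpace ⟶ (F.obj j).toSheafedSpace)
        (hf : f = (s.π.app j).toHom) :
        PrimeSpectrum.comap (f.hom.stalkMap y).hom z ∈ (F.obj j).primes (f.hom.base y) := by
      subst hf
      exact (s.π.app j).comap_mem y z hz
    have h' := key _ h
    have h₂ : (l ≫ coneProj c j).hom.stalkMap y =
        (coneProj c j).hom.stalkMap (l.hom.base y) ≫ l.hom.stalkMap y :=
      PresheafedSpace.stalkMap.comp l.hom (coneProj c j).hom y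
    rw [h₂] at h'
    exact h'⟩
  fac s j := Hom.ext (hc.fac (forgetToSheafedSpace.mapCone s) j)
  uniq s m hm := Hom.ext (hc.uniq (forgetToSheafedSpace.mapCone s) m.toHom
    fun j => congrArg Hom.toHom (hm j))

instance : HasLimits PrimedRingedSpace.{u} where
  has_limits_of_shape _ _ :=
    { has_limit := fun F => ⟨_, isLimitPrimedCone _ (limit.isLimit (F ⋙ forgetToSheafedSpace))⟩ }

end PrimedRingedSpace
end AlgebraicGeometry

end

open AlgebraicGeometry in
/-- The category of locally ringed spaces has all (small) limits. Moreover, for every small diagram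
`F` of locally ringed spaces, the diagram of primed ringed spaces obtained by equipping each `F j`
with its local prime system has a limit, and whenever `c` is such a limit, with projections
`p_j : c.pt ⟶ F j`, the localization of `c.pt` is the limit of `F` in locally ringed spaces, with
projections the composites `p_j ∘ π` of `p_j` with the projection `π` of the localization. -/
theorem mainTheorem4 :
    HasLimits LocallyRingedSpace.{u} ∧
    ∀ (J : Type u) [SmallCategory J] (F : J ⥤ LocallyRingedSpace.{u}),
      HasLimit (F ⋙ PrimedRingedSpace.ofLocallyRingedSpace) ∧
      ∀ c : Cone (F ⋙ PrimedRingedSpace.ofLocallyRingedSpace), IsLimit c →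
        ∃ p : (Functor.const J).obj c.pt.loc ⟶ F,
          (∀ j : J, PrimedRingedSpace.ofLocallyRingedSpace.map (p.app j) = c.pt.locπ ≫ c.π.app j) ∧
          Nonempty (IsLimit (Cone.mk c.pt.loc p)) := by
  have key (J : Type u) [SmallCategory J] (F : J ⥤ LocallyRingedSpace.{u})
      (c : Cone (F ⋙ PrimedRingedSpace.ofLocallyRingedSpace)) (hc : IsLimit c) :
      ∃ p : (Functor.const J).obj c.pt.loc ⟶ F,
        (∀ j : J, PrimedRingedSpace.ofLocallyRingedSpace.map (p.app j) =
          c.pt.locπ ≫ c.π.app j) ∧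
        Nonempty (IsLimit (Cone.mk c.pt.loc p)) := by
    obtain ⟨p, hp⟩ := PrimedRingedSpace.exists_locCone c
    exact ⟨p, hp, ⟨PrimedRingedSpace.isLimitLoc hc p hp⟩⟩
  refine ⟨⟨fun J _ => ⟨fun F => ?_⟩⟩, fun J _ F => ⟨inferInstance, key J F⟩⟩
  -- Localizing any one primed limit yields a limit of `F`.
  obtain ⟨p, -, ⟨hp⟩⟩ := key J F _ (limit.isLimit (F ⋙ PrimedRingedSpace.ofLocallyRingedSpace))
  exact ⟨_, hp⟩
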